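/- Let $N\ge 1$ and let $\mathcal H_A=\mathcal H_B=\mathbb C^N$. Let $\mathcal E_A,\mathcal E_B$ be quantum channels on the two systems, given by finitely many Kraus operators, $\mathcal E(\rho)=\sum_k E_k\rho E_k^\dagger$ with $\sum_k E_k^\dagger E_k=I$, and let $\mathcal E^\dagger(M)=\sum_k E_k^\dagger M E_k$ denote the adjoint map. Let $\mathcal M_a$ and $\mathcal M_b$ be elements of finite POVMs on $\mathcal H_A$ and $\mathcal H_B$ (for instance rank-one projectors $|\phi_a\rangle\langle\phi_a|$, $|\phi_b\rangle\langle\phi_b|$), and put $$\mathcal K_a=\mathcal E_A^\dagger(\mathcal M_a),\qquad \mathcal K_b=\mathcal E_B^\dagger(\mathcal M_b),\qquad \mathcal K_\phi=\mathcal K_a\otimes\mathcal K_b .$$ Let $\alpha_1\ge\dots\ge\alpha_N$ and $\beta_1\ge\dots\ge\beta_N$ be the eigenvalues, with multiplicity, of $\mathcal K_a$ and $\mathcal K_b$. For $s\in\mathbb R$ let $\mathbb H_s$ be the set of unit vectors $\psi\in\mathcal H_A\otimes\mathcal H_B$ whose entanglement entropy (the von Neumann entropy, with natural logarithm, of $\operatorname{Tr}_B|\psi\rangle\langle\psi|$)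 is at least $s$, and define $$J_{\min}(\mathcal K_\phi,s)=\min_{\psi\in\mathbb H_s}\langle\psi|\mathcal K_\phi|\psi\rangle,\qquad \sigma_{\min}(\mathcal K_\phi)=J_{\min}(\mathcal K_\phi,0),$$ so that $\sigma_{\min}(\mathcal K_\phi)$ is the minimum over all unit vectors. Put $\widetilde\mu_i=\alpha_i\beta_N$, $d_{\min}=\#\{j:\widetilde\mu_j=\widetilde\mu_N\}$, and $$\widetilde J_{\min}(\mathcal K_\phi,s)=\min\Big\{\sum_{j=1}^N\widetilde\mu_j\lambda_j:\ \lambda_j\ge 0,\ \sum_{j=1}^N\lambda_j=1,\ -\sum_{j=1}^N\lambda_j\log\lambda_j\ge s\Big\}.$$ Theorem. Let $s\le\log N$. Both minima $J_{\min}(\mathcal K_\phi,s)$ and $\widetilde J_{\min}(\mathcal K_\phi,s)$ are attained, $\widetilde\mu_N=\sigma_{\min}(\mathcal K_\phi)$, and $$J_{\min}(\mathcal K_\phi,s)\ \ge\ \widetilde J_{\min}(\mathcal K_\phi,s).$$ Moreover: (i) If $s\le\log d_{\min}$, then $\widetilde J_{\min}(\mathcal K_\phi,s)=\widetilde\mu_N=\sigma_{\min}(\mathcal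 K_\phi)$. (ii) If $\log d_{\min}<s\le\log N$, then, with $\widetilde Z(\gamma)=\sum_{j=1}^N e^{-\gamma\widetilde\mu_j}$, there is exactly one $\widetilde\gamma\ge 0$ satisfying the entropy equation $$\log\widetilde Z(\widetilde\gamma)+\frac{\widetilde\gamma}{\widetilde Z(\widetilde\gamma)}\sum_{j=1}^N\widetilde\mu_j e^{-\widetilde\gamma\widetilde\mu_j}=s .$$ It satisfies $\widetilde\gamma>0$ if $s<\log N$, and $$\widetilde J_{\min}(\mathcal K_\phi,s)=\frac1{\widetilde Z(\widetilde\gamma)}\sum_{j=1}^N\widetilde\mu_j e^{-\widetilde\gamma\widetilde\mu_j}>\sigma_{\min}(\mathcal K_\phi).$$ (iii) If $s=\log N$, then $$J_{\min}(\mathcal K_\phi,\log N)=\frac1N\sum_{i=1}^N\alpha_i\beta_{N-i+1},\qquad \widetilde J_{\min}(\mathcal K_\phi,\log N)=\frac1N\sum_{i=1}^N\widetilde\mu_i,$$ and $J_{\min}(\mathcal K_\phi,t)\le J_{\min}(\mathcal K_\phi,\log N)$ for every $t\le\log N$. -/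

import Mathlib

open scoped Matrix Kronecker ComplexOrder

noncomputable section

namespace QPrivacy

/-- A quantum channel on an `N`-dimensional system, given by finitely many Kraus operators `E k` with
`∑ k, (E k)ᴴ * E k = 1`. -/
structure Channel (N : ℕ) where
  size : ℕ
  kraus : Fin size → Matrix (Fin N) (Fin N) ℂ
  sum_eq_one : ∑ k, (kraus k)ᴴ * kraus k = 1

/-- The action of the channel on operators, `ρ ↦ ∑ k, E k * ρ * (E k)ᴴ`. -/
def Channel.apply {N : ℕ} (E : Channel N) (ρ : Matrix (Fin N) (Fin N) ℂ) :
    Matrix (Fin N) (Fin N) ℂ :=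
  ∑ k, E.kraus k * ρ * (E.kraus k)ᴴ

/-- The adjoint (Heisenberg picture) map, `M ↦ ∑ k, (E k)ᴴ * M * E k`. -/
def Channel.adjoint {N : ℕ} (E : Channel N) (M : Matrix (Fin N) (Fin N) ℂ) :
    Matrix (Fin N) (Fin N) ℂ :=
  ∑ k, (E.kraus k)ᴴ * M * E.kraus k

theorem Channel.trace_mul_apply {N : ℕ} (E : Channel N) (M ρ : Matrix (Fin N) (Fin N) ℂ) :
    (M * E.apply ρ).trace = (E.adjoint M * ρ).trace := by
  simp only [Channel.apply, Channel.adjoint, Finset.mul_sum, Finset.sum_mul, Matrix.trace_sum]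
  refine Finset.sum_congr rfl fun k _ => ?_
  rw [← Matrix.mul_assoc, Matrix.trace_mul_comm]
  simp only [Matrix.mul_assoc]

/-- A positive operator-valued measurement with finite outcome set `O`. -/
structure POVM (N : ℕ) (O : Type*) [Fintype O] where
  elem : O → Matrix (Fin N) (Fin N) ℂ
  posSemidef : ∀ k, (elem k).PosSemidef
  sum_eq_one : ∑ k, elem k = 1

/-- The local observable `E†(M_a)` induced by the channel `E` and the outcome `a`. -/
def localObservable {N : ℕ} {O : Type*} [Fintype O] (E : Channel N) (M : POVM N O) (a : O) :
    Matrix (Fin N) (Fin N) ℂ :=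
  E.adjoint (M.elem a)

theorem localObservable_isHermitian {N : ℕ} {O : Type*} [Fintype O] (E : Channel N)
    (M : POVM N O) (a : O) : (localObservable E M a).IsHermitian := by
  unfold localObservable Channel.adjoint
  rw [Matrix.IsHermitian, Matrix.conjTranspose_sum]
  refine Finset.sum_congr rfl fun k _ => ?_
  simp [Matrix.conjTranspose_mul, (M.posSemidef a).isHermitian.eq, Matrix.mul_assoc]

/-- The eigenvalues of a Hermitian matrix, listed with multiplicity in nonincreasing order. -/
def sortedEigenvalues {N : ℕ} {K : Matrix (Fin N) (Fin N) ℂ} (hK : K.IsHermitian) (i : Fin N) : ℝ :=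
  hK.eigenvalues₀ (Fin.cast (Fintype.card_fin N).symm i)

/-- The operator `|ψ⟩⟨ψ|`. -/
def pureDensity {N : ℕ} (ψ : EuclideanSpace ℂ (Fin N × Fin N)) :
    Matrix (Fin N × Fin N) (Fin N × Fin N) ℂ :=
  Matrix.of fun x y => ψ x * star (ψ y)

/-- The partial trace over the second tensor factor. -/
def partialTraceB {N : ℕ} (ρ : Matrix (Fin N × Fin N) (Fin N × Fin N) ℂ) :
    Matrix (Fin N) (Fin N) ℂ :=
  Matrix.of fun i j => ∑ k, ρ (i, k) (j, k)

theorem reducedState_isHermitian {N : ℕ} (ψ : EuclideanSpace ℂ (Fin N × Fin N)) :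
    (partialTraceB (pureDensity ψ)).IsHermitian := by
  ext i j
  simp [partialTraceB, pureDensity, Matrix.conjTranspose_apply, mul_comm]

/-- The von Neumann entropy `-∑ λ_j log λ_j` of a Hermitian matrix with eigenvalues `λ_j`. -/
def vonNeumannEntropy {N : ℕ} {ρ : Matrix (Fin N) (Fin N) ℂ} (hρ : ρ.IsHermitian) : ℝ :=
  ∑ i, Real.negMulLog (hρ.eigenvalues i)

/-- The entanglement entropy of a bipartite pure state. -/
def entanglementEntropy {N : ℕ} (ψ : EuclideanSpace ℂ (Fin N × Fin N)) : ℝ :=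
  vonNeumannEntropy (reducedState_isHermitian ψ)

/-- Pure states (unit vectors of `ℂ^N ⊗ ℂ^N`) with entanglement entropy at least `s`. -/
def entangledStates (N : ℕ) (s : ℝ) : Set (EuclideanSpace ℂ (Fin N × Fin N)) :=
  {ψ | ‖ψ‖ = 1 ∧ s ≤ entanglementEntropy ψ}

/-- The energy `⟨ψ|K|ψ⟩` (which is a real number when `K` is Hermitian). -/
def energy {N : ℕ} (K : Matrix (Fin N × Fin N) (Fin N × Fin N) ℂ)
    (ψ : EuclideanSpace ℂ (Fin N × Fin N)) : ℝ :=
  (star ψ.ofLp ⬝ᵥ (K *ᵥ ψ.ofLp)).re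

/-- The minimal privacy energy over the states with entanglement entropy at least `s`. -/
def Jmin {N : ℕ} (K : Matrix (Fin N × Fin N) (Fin N × Fin N) ℂ) (s : ℝ) : ℝ :=
  sInf (energy K '' entangledStates N s)

/-- The minimal energy over all pure states, i.e. without an entanglement constraint. -/
def sigmaMin {N : ℕ} (K : Matrix (Fin N × Fin N) (Fin N × Fin N) ℂ) : ℝ :=
  Jmin K 0

/-- Probability vectors with Shannon entropy at least `s`. -/
def entropicSimplex (N : ℕ) (s : ℝ) : Set (Fin N → ℝ) :=
  {p | p ∈ stdSimplex ℝ (Fin N) ∧ s ≤ ∑ j, Real.negMulLog (p j)}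

/-- The relaxed minimal energy with levels `μ`: the minimum of `∑ j, μ j * p j` over probability
vectors `p` with Shannon entropy at least `s`. -/
def relaxedJmin {N : ℕ} (μ : Fin N → ℝ) (s : ℝ) : ℝ :=
  sInf ((fun p : Fin N → ℝ => ∑ j, μ j * p j) '' entropicSimplex N s)

/-- The partition function `Z(γ) = ∑ j, exp (-γ μ_j)`. -/
def partitionFn {N : ℕ} (μ : Fin N → ℝ) (γ : ℝ) : ℝ :=
  ∑ j, Real.exp (-γ * μ j)

/-- The Gibbs average `Z(γ)⁻¹ ∑ j, μ_j exp (-γ μ_j)`. -/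
def gibbsAverage {N : ℕ} (μ : Fin N → ℝ) (γ : ℝ) : ℝ :=
  (partitionFn μ γ)⁻¹ * ∑ j, μ j * Real.exp (-γ * μ j)

end QPrivacy

end

/-!
In product eigenbases of `K_a` and `K_b`, a unit vector with amplitude matrix `C` has energy
`∑ i j, α i * β j * ‖C i j‖ ^ 2`. Replacing every `β j` by the smallest one leaves the average of
the levels `μ i` over the diagonal of the reduced state, and by concavity the Shannon entropy of
that diagonal is at least the entanglement entropy; so the relaxed minimum is a lower bound. The
relaxed minimum itself is the Gibbs variational principle, i.e. the nonnegativity of the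
Kullback-Leibler divergence from a Gibbs distribution. At `s = log N` the matrix `√N • C` is
unitary, hence `N * ‖C i j‖ ^ 2` is doubly stochastic, and Birkhoff's theorem with the rearrangement
inequality gives the minimum.
-/

namespace QPrivacy

open Finset Real Filter Topology InformationTheory

/-! ### Shannon entropy -/

section Shannon

variable {ι : Type*} [Fintype ι]

/-- The Shannon entropy `-∑ p_j log p_j`, with natural logarithm, of a finite vector. -/
noncomputable def shannonEntropy (p : ι → ℝ) : ℝ :=
  ∑ j, negMulLog (p j)

/-- The cross entropy `-∑ p_j log q_j` of `p` relative to `q`; it exceeds the Shannon entropy of `p`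
by the Kullback-Leibler divergence. -/
noncomputable def crossEntropy (p q : ι → ℝ) : ℝ :=
  -∑ j, p j * log (q j)

theorem crossEntropy_self (p : ι → ℝ) : crossEntropy p p = shannonEntropy p := by
  simp only [crossEntropy, shannonEntropy, negMulLog, neg_mul, sum_neg_distrib]

theorem crossEntropy_sub_shannonEntropy {p q : ι → ℝ} (hq : ∀ j, 0 < q j)
    (hpq : ∑ j, p j = ∑ j, q j) :
    crossEntropy p q - shannonEntropy p = ∑ j, q j * klFun (p j / q j) := by
  have hterm (j : ι) :
      q j * klFun (p j / q j) = q j - p j - p j * log (q j) - negMulLog (p j) := by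
    have hqj := (hq j).ne'
    rcases eq_or_ne (p j) 0 with hp | hp
    · simp [hp, klFun_zero]
    · rw [klFun_apply, log_div hp hqj, negMulLog]
      field_simp
      ring
  simp only [hterm, sum_sub_distrib, hpq, crossEntropy, shannonEntropy]
  ring

theorem shannonEntropy_lt_crossEntropy {p q : ι → ℝ} (hp : ∀ j, 0 ≤ p j) (hq : ∀ j, 0 < q j)
    (hpq : ∑ j, p j = ∑ j, q j) (hne : p ≠ q) : shannonEntropy p < crossEntropy p q := by
  obtain ⟨i, hi⟩ := Function.ne_iff.mp hne
  have hratio (j : ι) : 0 ≤ p j / q j := div_nonneg (hp j) (hq j).le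
  have hklFun : 0 < klFun (p i / q i) :=
    (klFun_nonneg (hratio i)).lt_of_ne' fun h =>
      hi ((div_eq_one_iff_eq (hq i).ne').mp ((klFun_eq_zero_iff (hratio i)).mp h))
  rw [← sub_pos, crossEntropy_sub_shannonEntropy hq hpq]
  exact sum_pos' (fun j _ => mul_nonneg (hq j).le (klFun_nonneg (hratio j)))
    ⟨i, mem_univ i, mul_pos (hq i) hklFun⟩

theorem shannonEntropy_le_crossEntropy {p q : ι → ℝ} (hp : ∀ j, 0 ≤ p j) (hq : ∀ j, 0 < q j)
    (hpq : ∑ j, p j = ∑ j, q j) : shannonEntropy p ≤ crossEntropy p q := by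
  rcases eq_or_ne p q with rfl | hne
  · exact (crossEntropy_self p).ge
  · exact (shannonEntropy_lt_crossEntropy hp hq hpq hne).le

theorem shannonEntropy_nonneg {p : ι → ℝ} (hp : p ∈ stdSimplex ℝ ι) : 0 ≤ shannonEntropy p :=
  sum_nonneg fun j _ => negMulLog_nonneg (hp.1 j) (mem_Icc_of_mem_stdSimplex hp j).2

theorem continuous_shannonEntropy : Continuous (shannonEntropy : (ι → ℝ) → ℝ) := by
  unfold shannonEntropy
  fun_prop

theorem shannonEntropy_le_shannonEntropy_mulVec [DecidableEq ι] {D : Matrix ι ι ℝ}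
    (hD : D ∈ doublyStochastic ℝ ι) {p : ι → ℝ} (hp : ∀ j, 0 ≤ p j) :
    shannonEntropy p ≤ shannonEntropy (D *ᵥ p) :=
  calc shannonEntropy p = ∑ j, (∑ i, D i j) * negMulLog (p j) := by
        simp only [sum_col_of_mem_doublyStochastic hD, one_mul, shannonEntropy]
    _ = ∑ i, ∑ j, D i j • negMulLog (p j) := by
        simp only [sum_mul, smul_eq_mul]
        exact sum_comm
    _ ≤ ∑ i, negMulLog (∑ j, D i j • p j) :=
        sum_le_sum fun i _ => concaveOn_negMulLog.le_map_sum
          (fun _ _ => nonneg_of_mem_doublyStochastic hD)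
          (sum_row_of_mem_doublyStochastic hD i) fun j _ => hp j

variable [DecidableEq ι]

/-- The uniform probability vector on a finite set of indices (the zero vector if it is empty). -/
noncomputable def uniformOn (S : Finset ι) (j : ι) : ℝ :=
  if j ∈ S then (#S : ℝ)⁻¹ else 0

theorem uniformOn_univ : uniformOn (univ : Finset ι) = fun _ => (Fintype.card ι : ℝ)⁻¹ := by
  ext j
  simp [uniformOn]

theorem uniformOn_mem_stdSimplex {S : Finset ι} (hS : S.Nonempty) :
    uniformOn S ∈ stdSimplex ℝ ι := by
  refine ⟨fun j => ?_, ?_⟩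
  · unfold uniformOn
    positivity
  · simp [uniformOn, hS.ne_empty]

theorem sum_mul_uniformOn (μ : ι → ℝ) (S : Finset ι) :
    ∑ j, μ j * uniformOn S j = (#S : ℝ)⁻¹ * ∑ j ∈ S, μ j := by
  simp [uniformOn, ← sum_mul, mul_comm]

theorem shannonEntropy_uniformOn (S : Finset ι) : shannonEntropy (uniformOn S) = log #S := by
  simp only [shannonEntropy, uniformOn, apply_ite negMulLog, negMulLog_zero, sum_ite_mem,
    univ_inter, sum_const, nsmul_eq_mul]
  rcases S.eq_empty_or_nonempty with rfl | hS
  · simp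
  · have hcard : (#S : ℝ) ≠ 0 := by simpa using hS.ne_empty
    rw [negMulLog, log_inv]
    field_simp

theorem log_card_le_shannonEntropy_iff [Nonempty ι] {p : ι → ℝ} (hp : p ∈ stdSimplex ℝ ι) :
    log (Fintype.card ι) ≤ shannonEntropy p ↔ p = uniformOn univ := by
  have huniform := uniformOn_mem_stdSimplex (univ_nonempty (α := ι))
  have hcross : crossEntropy p (uniformOn univ) = log (Fintype.card ι) := by
    simp [crossEntropy, uniformOn_univ, ← sum_mul, hp.2]
  refine ⟨fun h => ?_, fun h => by rw [h, shannonEntropy_uniformOn, card_univ]⟩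
  by_contra hne
  refine (shannonEntropy_lt_crossEntropy hp.1 (fun j => ?_) (hp.2.trans huniform.2.symm)
    hne).not_ge (hcross.trans_le h)
  simp [uniformOn_univ, Fintype.card_pos]

end Shannon

/-! ### Gibbs distributions -/

variable {N : ℕ}

/-- The Gibbs distribution of the levels `μ` at inverse temperature `γ`, normalized by
`partitionFn μ γ`. -/
noncomputable def gibbs (μ : Fin N → ℝ) (γ : ℝ) (j : Fin N) : ℝ :=
  exp (-γ * μ j) / partitionFn μ γ

section Gibbs

theorem gibbsAverage_eq_sum (μ : Fin N → ℝ) (γ : ℝ) :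
    gibbsAverage μ γ = ∑ j, μ j * gibbs μ γ j := by
  rw [gibbsAverage, mul_sum]
  exact sum_congr rfl fun j _ => by rw [gibbs]; ring

theorem gibbs_sub_const (μ : Fin N → ℝ) (c γ : ℝ) :
    gibbs (fun j => μ j - c) γ = gibbs μ γ := by
  have hexp (j : Fin N) : exp (-γ * (μ j - c)) = exp (-γ * μ j) * exp (γ * c) := by
    rw [← exp_add]
    ring_nf
  ext j
  simp only [gibbs, partitionFn, hexp, ← sum_mul]
  exact mul_div_mul_right _ _ (exp_pos _).ne'

theorem gibbs_zero (μ : Fin N → ℝ) : gibbs μ 0 = uniformOn univ := by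
  ext j
  simp [gibbs, partitionFn, uniformOn_univ]

theorem tendsto_gibbs_atTop {μ : Fin N → ℝ} {i₀ : Fin N} (hmin : ∀ j, μ i₀ ≤ μ j) :
    Tendsto (gibbs μ) atTop (𝓝 (uniformOn {j | μ j = μ i₀})) := by
  have hweight (j : Fin N) : Tendsto (fun γ => exp (-γ * (μ j - μ i₀))) atTop
      (𝓝 (if μ j = μ i₀ then 1 else 0)) := by
    split_ifs with hj
    · simp [hj]
    · have hgap : 0 < μ j - μ i₀ := sub_pos.mpr ((hmin j).lt_of_ne' hj)
      simp only [neg_mul]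
      exact tendsto_exp_neg_atTop_nhds_zero.comp (tendsto_id.atTop_mul_const hgap)
  have hpartition : Tendsto (partitionFn fun j => μ j - μ i₀) atTop
      (𝓝 (#{j | μ j = μ i₀} : ℝ)) := by
    rw [← sum_boole]
    exact tendsto_finsetSum univ fun j _ => hweight j
  have hcard : (#{j | μ j = μ i₀} : ℝ) ≠ 0 :=
    Nat.cast_ne_zero.mpr (card_ne_zero_of_mem (a := i₀) (by simp))
  rw [← funext (gibbs_sub_const μ (μ i₀))]
  refine tendsto_pi_nhds.mpr fun j => ?_
  have hlim : uniformOn {j | μ j = μ i₀} j = (if μ j = μ i₀ then 1 else 0) / #{j | μ j = μ i₀} := by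
    simp [uniformOn, ite_div]
  exact hlim ▸ (hweight j).div hpartition hcard

theorem exists_ne_of_log_card_lt {μ : Fin N → ℝ} {i₀ : Fin N}
    (h : log #{j | μ j = μ i₀} < log N) : ∃ i, μ i ≠ μ i₀ := by
  by_contra! hconst
  simp [hconst] at h

variable [NeZero N] (μ : Fin N → ℝ) (γ : ℝ)

theorem partitionFn_pos : 0 < partitionFn μ γ :=
  sum_pos (fun _ _ => exp_pos _) univ_nonempty

theorem gibbs_pos (j : Fin N) : 0 < gibbs μ γ j :=
  div_pos (exp_pos _) (partitionFn_pos μ γ)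

theorem gibbs_mem_stdSimplex : gibbs μ γ ∈ stdSimplex ℝ (Fin N) := by
  refine ⟨fun j => (gibbs_pos μ γ j).le, ?_⟩
  simp only [gibbs, ← sum_div]
  exact div_self (partitionFn_pos μ γ).ne'

theorem log_gibbs (j : Fin N) : log (gibbs μ γ j) = -γ * μ j - log (partitionFn μ γ) := by
  rw [gibbs, log_div (exp_pos _).ne' (partitionFn_pos μ γ).ne', log_exp]

theorem continuous_gibbs : Continuous (gibbs μ) := by
  unfold gibbs partitionFn
  exact continuous_pi fun j => Continuous.div (by fun_prop) (by fun_prop)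
    fun γ => (partitionFn_pos μ γ).ne'

theorem crossEntropy_gibbs {p : Fin N → ℝ} (hp : p ∈ stdSimplex ℝ (Fin N)) :
    crossEntropy p (gibbs μ γ) = log (partitionFn μ γ) + γ * ∑ j, μ j * p j := by
  have hterm (j : Fin N) : p j * log (gibbs μ γ j) =
      -(γ * (μ j * p j)) - p j * log (partitionFn μ γ) := by
    rw [log_gibbs]
    ring
  simp only [crossEntropy, hterm, sum_sub_distrib, sum_neg_distrib, ← mul_sum, ← sum_mul, hp.2]
  ring

theorem shannonEntropy_gibbs :
    shannonEntropy (gibbs μ γ) = log (partitionFn μ γ) + γ * gibbsAverage μ γ := by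
  rw [← crossEntropy_self, crossEntropy_gibbs μ γ (gibbs_mem_stdSimplex μ γ), gibbsAverage_eq_sum]

variable {μ γ}

theorem gibbs_injective (hμ : ∃ i j, μ i ≠ μ j) : Function.Injective (gibbs μ) := by
  intro γ γ' h
  obtain ⟨i, j, hij⟩ := hμ
  have hlog (k : Fin N) :
      -γ * μ k - log (partitionFn μ γ) = -γ' * μ k - log (partitionFn μ γ') := by
    rw [← log_gibbs, ← log_gibbs, h]
  have hprod : (γ - γ') * (μ i - μ j) = 0 := by linarith [hlog i, hlog j]
  exact sub_eq_zero.mp ((mul_eq_zero.mp hprod).resolve_right (sub_ne_zero.mpr hij))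

theorem shannonEntropy_gibbs_lt {γ' : ℝ} (hμ : ∃ i j, μ i ≠ μ j) (hne : γ ≠ γ') :
    shannonEntropy (gibbs μ γ) < log (partitionFn μ γ') + γ' * gibbsAverage μ γ := by
  have hmem := gibbs_mem_stdSimplex μ γ
  rw [gibbsAverage_eq_sum, ← crossEntropy_gibbs μ γ' hmem]
  exact shannonEntropy_lt_crossEntropy hmem.1 (gibbs_pos μ γ')
    (hmem.2.trans (gibbs_mem_stdSimplex μ γ').2.symm) ((gibbs_injective hμ).ne hne)

theorem strictAnti_gibbsAverage (hμ : ∃ i j, μ i ≠ μ j) : StrictAnti (gibbsAverage μ) := by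
  intro γ γ' hlt
  have hle := shannonEntropy_gibbs_lt hμ hlt.ne
  have hge := shannonEntropy_gibbs_lt hμ hlt.ne'
  rw [shannonEntropy_gibbs] at hle hge
  have hprod : 0 < (γ' - γ) * (gibbsAverage μ γ - gibbsAverage μ γ') := by linarith
  exact sub_pos.mp ((mul_pos_iff_of_pos_left (sub_pos.mpr hlt)).mp hprod)

theorem strictAntiOn_shannonEntropy_gibbs (hμ : ∃ i j, μ i ≠ μ j) :
    StrictAntiOn (fun γ => shannonEntropy (gibbs μ γ)) (Set.Ici 0) := by
  intro γ hγ γ' _ hlt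
  calc shannonEntropy (gibbs μ γ')
      < log (partitionFn μ γ) + γ * gibbsAverage μ γ' := shannonEntropy_gibbs_lt hμ hlt.ne'
    _ ≤ log (partitionFn μ γ) + γ * gibbsAverage μ γ :=
        add_le_add_right (mul_le_mul_of_nonneg_left (strictAnti_gibbsAverage hμ hlt).le hγ) _
    _ = shannonEntropy (gibbs μ γ) := (shannonEntropy_gibbs μ γ).symm

theorem existsUnique_shannonEntropy_gibbs_eq {i₀ : Fin N} (hmin : ∀ j, μ i₀ ≤ μ j) {s : ℝ}
    (hground : log #{j | μ j = μ i₀} < s) (hs : s ≤ log N) :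
    ∃! γ, 0 ≤ γ ∧ shannonEntropy (gibbs μ γ) = s := by
  obtain ⟨i, hi⟩ := exists_ne_of_log_card_lt (hground.trans_le hs)
  have hlim := (continuous_shannonEntropy.tendsto _).comp (tendsto_gibbs_atTop hmin)
  rw [shannonEntropy_uniformOn] at hlim
  obtain ⟨γ₁, hγ₁s, hγ₁⟩ :=
    ((hlim.eventually (gt_mem_nhds hground)).and (eventually_ge_atTop 0)).exists
  have hzero : s ≤ shannonEntropy (gibbs μ 0) := by
    simpa [gibbs_zero, shannonEntropy_uniformOn] using hs
  obtain ⟨γ, hγ, hγs⟩ := intermediate_value_Icc' hγ₁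
    (continuous_shannonEntropy.comp (continuous_gibbs μ)).continuousOn ⟨hγ₁s.le, hzero⟩
  exact ⟨γ, ⟨hγ.1, hγs⟩, fun γ' h =>
    (strictAntiOn_shannonEntropy_gibbs ⟨i, i₀, hi⟩).injOn h.1 hγ.1 (h.2.trans hγs.symm)⟩

end Gibbs

/-! ### The relaxed minimum -/

section Relaxed

variable {μ : Fin N → ℝ} {i₀ : Fin N} {s : ℝ}

theorem isCompact_entropicSimplex (N : ℕ) (s : ℝ) : IsCompact (entropicSimplex N s) :=
  (isCompact_stdSimplex ℝ (Fin N)).inter_right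
    (isClosed_le continuous_const continuous_shannonEntropy)

theorem uniformOn_univ_mem_entropicSimplex [NeZero N] (hs : s ≤ log N) :
    uniformOn univ ∈ entropicSimplex N s :=
  ⟨uniformOn_mem_stdSimplex univ_nonempty,
    hs.trans_eq (by rw [← shannonEntropy, shannonEntropy_uniformOn, card_univ, Fintype.card_fin])⟩

theorem isLeast_relaxedJmin [NeZero N] (μ : Fin N → ℝ) (hs : s ≤ log N) :
    IsLeast ((fun p : Fin N → ℝ => ∑ j, μ j * p j) '' entropicSimplex N s) (relaxedJmin μ s) :=
  ((isCompact_entropicSimplex N s).image (by fun_prop)).isLeast_sInf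
    ⟨_, Set.mem_image_of_mem _ (uniformOn_univ_mem_entropicSimplex hs)⟩

theorem relaxedJmin_eq_of_forall_le {p : Fin N → ℝ} (hp : p ∈ entropicSimplex N s)
    (hmin : ∀ q ∈ entropicSimplex N s, ∑ j, μ j * p j ≤ ∑ j, μ j * q j) :
    relaxedJmin μ s = ∑ j, μ j * p j :=
  IsLeast.csInf_eq ⟨⟨p, hp, rfl⟩, by rintro _ ⟨q, hq, rfl⟩; exact hmin q hq⟩

theorem relaxedJmin_eq_of_le_log_card (hmin : ∀ j, μ i₀ ≤ μ j)
    (hs : s ≤ log #{j | μ j = μ i₀}) : relaxedJmin μ s = μ i₀ := by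
  have hcard : (#{j | μ j = μ i₀} : ℝ) ≠ 0 :=
    Nat.cast_ne_zero.mpr (card_ne_zero_of_mem (a := i₀) (by simp))
  have hground : ∑ j, μ j * uniformOn {j | μ j = μ i₀} j = μ i₀ := by
    rw [sum_mul_uniformOn, sum_congr rfl fun j hj => (mem_filter.mp hj).2, sum_const,
      nsmul_eq_mul, inv_mul_cancel_left₀ hcard]
  rw [relaxedJmin_eq_of_forall_le (p := uniformOn {j | μ j = μ i₀}), hground]
  · exact ⟨uniformOn_mem_stdSimplex ⟨i₀, by simp⟩, hs.trans_eq (shannonEntropy_uniformOn _).symm⟩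
  · intro q hq
    calc ∑ j, μ j * uniformOn {j | μ j = μ i₀} j = ∑ j, μ i₀ * q j := by
          rw [hground, ← mul_sum, hq.1.2, mul_one]
      _ ≤ ∑ j, μ j * q j := sum_le_sum fun j _ => mul_le_mul_of_nonneg_right (hmin j) (hq.1.1 j)

variable [NeZero N]

theorem eq_uniformOn_univ_of_mem_entropicSimplex_log {p : Fin N → ℝ}
    (hp : p ∈ entropicSimplex N (log N)) : p = uniformOn univ :=
  (log_card_le_shannonEntropy_iff hp.1).mp (by rw [Fintype.card_fin]; exact hp.2)

theorem relaxedJmin_log (μ : Fin N → ℝ) : relaxedJmin μ (log N) = 1 / N * ∑ i, μ i := by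
  rw [relaxedJmin_eq_of_forall_le (uniformOn_univ_mem_entropicSimplex le_rfl) fun q hq => by
    rw [eq_uniformOn_univ_of_mem_entropicSimplex_log hq], sum_mul_uniformOn]
  simp

theorem relaxedJmin_shannonEntropy_gibbs {γ : ℝ} (hγ : 0 ≤ γ) :
    relaxedJmin μ (shannonEntropy (gibbs μ γ)) = gibbsAverage μ γ := by
  have hmem := gibbs_mem_stdSimplex μ γ
  rw [gibbsAverage_eq_sum]
  refine relaxedJmin_eq_of_forall_le ⟨hmem, le_rfl⟩ fun q hq => ?_
  rcases hγ.eq_or_lt with rfl | hγ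
  · rw [eq_uniformOn_univ_of_mem_entropicSimplex_log (p := q), gibbs_zero]
    simpa [gibbs_zero, shannonEntropy_uniformOn] using hq
  · have hgibbs : shannonEntropy (gibbs μ γ) ≤ crossEntropy q (gibbs μ γ) :=
      hq.2.trans (shannonEntropy_le_crossEntropy hq.1.1 (gibbs_pos μ γ) (hq.1.2.trans hmem.2.symm))
    rw [shannonEntropy_gibbs, gibbsAverage_eq_sum, crossEntropy_gibbs μ γ hq.1] at hgibbs
    exact le_of_mul_le_mul_left (le_of_add_le_add_left hgibbs) hγ

theorem lt_gibbsAverage (hmin : ∀ j, μ i₀ ≤ μ j) {i : Fin N} (hi : μ i ≠ μ i₀) (γ : ℝ) :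
    μ i₀ < gibbsAverage μ γ := by
  rw [gibbsAverage_eq_sum]
  calc μ i₀ = ∑ j, μ i₀ * gibbs μ γ j := by
        rw [← mul_sum, (gibbs_mem_stdSimplex μ γ).2, mul_one]
    _ < ∑ j, μ j * gibbs μ γ j := sum_lt_sum
        (fun j _ => mul_le_mul_of_nonneg_right (hmin j) (gibbs_pos μ γ j).le)
        ⟨i, mem_univ i, mul_lt_mul_of_pos_right ((hmin i).lt_of_ne' hi) (gibbs_pos μ γ i)⟩

theorem exists_relaxedJmin_eq_gibbsAverage (hmin : ∀ j, μ i₀ ≤ μ j)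
    (hground : log #{j | μ j = μ i₀} < s) (hs : s ≤ log N) :
    ∃ γ, 0 ≤ γ ∧ (s < log N → 0 < γ) ∧ log (partitionFn μ γ) + γ * gibbsAverage μ γ = s ∧
      (∀ γ', 0 ≤ γ' → log (partitionFn μ γ') + γ' * gibbsAverage μ γ' = s → γ' = γ) ∧
      relaxedJmin μ s = gibbsAverage μ γ ∧ μ i₀ < relaxedJmin μ s := by
  obtain ⟨i, hi⟩ := exists_ne_of_log_card_lt (hground.trans_le hs)
  obtain ⟨γ, ⟨hγ, rfl⟩, hunique⟩ := existsUnique_shannonEntropy_gibbs_eq hmin hground hs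
  have hrelaxed := relaxedJmin_shannonEntropy_gibbs (μ := μ) hγ
  refine ⟨γ, hγ, fun hlt => hγ.lt_of_ne' ?_, (shannonEntropy_gibbs μ γ).symm,
    fun γ' hγ' h => hunique γ' ⟨hγ', (shannonEntropy_gibbs μ γ').trans h⟩, hrelaxed,
    hrelaxed ▸ lt_gibbsAverage hmin hi γ⟩
  rintro rfl
  simp [gibbs_zero, shannonEntropy_uniformOn] at hlt

end Relaxed

/-! ### Unitary matrices and doubly stochastic matrices -/

section UnitaryMatrices

open Matrix

variable {n : Type*} [Fintype n] [DecidableEq n]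

/-- The matrix of squared moduli `‖W i j‖ ^ 2`; for unitary `W` these are the transition
probabilities between two orthonormal bases. -/
noncomputable def transitionMatrix (W : Matrix n n ℂ) : Matrix n n ℝ :=
  W.map fun z => ‖z‖ ^ 2

omit [DecidableEq n] in
theorem mul_conjTranspose_self_apply_self (W : Matrix n n ℂ) (i : n) :
    (W * Wᴴ) i i = ((∑ j, transitionMatrix W i j : ℝ) : ℂ) := by
  simp [mul_apply, transitionMatrix, Complex.mul_conj']

theorem transitionMatrix_mem_doublyStochastic {W : Matrix n n ℂ} (hW : W ∈ unitaryGroup n ℂ) :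
    transitionMatrix W ∈ doublyStochastic ℝ n := by
  have hrow {X : Matrix n n ℂ} (hX : X ∈ unitaryGroup n ℂ) (i : n) :
      ∑ j, transitionMatrix X i j = 1 := by
    apply Complex.ofReal_injective
    rw [← mul_conjTranspose_self_apply_self, ← star_eq_conjTranspose,
      mem_unitaryGroup_iff.mp hX, one_apply_eq, Complex.ofReal_one]
  refine mem_doublyStochastic_iff_sum.mpr
    ⟨fun i j => sq_nonneg _, hrow hW, fun j => ?_⟩
  simpa [transitionMatrix] using hrow (transpose_mem_unitaryGroup_iff.mpr hW) j

omit [Fintype n] [DecidableEq n] in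
theorem transitionMatrix_smul (c : ℂ) (W : Matrix n n ℂ) :
    transitionMatrix (c • W) = ‖c‖ ^ 2 • transitionMatrix W := by
  ext
  simp [transitionMatrix, mul_pow]

omit [Fintype n] in
theorem transitionMatrix_single (i j : n) : transitionMatrix (single i j 1) = single i j 1 := by
  ext
  simp [transitionMatrix, single_apply, apply_ite]

omit [Fintype n] in
theorem transitionMatrix_permMatrix (σ : Equiv.Perm n) :
    transitionMatrix (σ.permMatrix ℂ) = σ.permMatrix ℝ := by
  ext
  simp [transitionMatrix, PEquiv.toMatrix_apply, apply_ite]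

theorem dotProduct_le_dotProduct_mulVec_of_mem_doublyStochastic {f g : n → ℝ} {σ : Equiv.Perm n}
    (hfg : Antivary f (g ∘ σ)) {D : Matrix n n ℝ} (hD : D ∈ doublyStochastic ℝ n) :
    f ⬝ᵥ (g ∘ σ) ≤ f ⬝ᵥ (D *ᵥ g) := by
  obtain ⟨w, hw, hw_sum, rfl⟩ := exists_eq_sum_perm_of_mem_doublyStochastic hD
  have hperm (τ : Equiv.Perm n) : f ⬝ᵥ (g ∘ σ) ≤ f ⬝ᵥ (g ∘ τ) := by
    simpa [dotProduct] using hfg.sum_mul_le_sum_mul_comp_perm (σ := σ⁻¹ * τ)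
  calc f ⬝ᵥ (g ∘ σ) = ∑ τ, w τ * (f ⬝ᵥ (g ∘ σ)) := by rw [← sum_mul, hw_sum, one_mul]
    _ ≤ ∑ τ, w τ * (f ⬝ᵥ (g ∘ τ)) :=
        sum_le_sum fun τ _ => mul_le_mul_of_nonneg_left (hperm τ) (hw τ)
    _ = f ⬝ᵥ ((∑ τ, w τ • τ.permMatrix ℝ) *ᵥ g) := by
        simp only [sum_mulVec, smul_mulVec, permMatrix_mulVec, dotProduct_sum, dotProduct_smul,
          smul_eq_mul]

/-- The matrix `W D Wᴴ` with `D` the real diagonal matrix of `d`. For unitary `W` it is the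
Hermitian matrix with eigenvalues `d` and eigenvectors the columns of `W`. -/
noncomputable def spectralMatrix (W : Matrix n n ℂ) (d : n → ℝ) : Matrix n n ℂ :=
  W * diagonal (fun i => (d i : ℂ)) * Wᴴ

theorem spectralMatrix_apply_self (W : Matrix n n ℂ) (d : n → ℝ) (i : n) :
    spectralMatrix W d i i = ((transitionMatrix W *ᵥ d) i : ℂ) := by
  simp only [spectralMatrix, transitionMatrix, mul_apply (M := W * _), mul_diagonal,
    conjTranspose_apply, RCLike.star_def, mulVec, dotProduct, map_apply, Complex.ofReal_sum,
    Complex.ofReal_mul, Complex.ofReal_pow, ← Complex.mul_conj']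
  exact sum_congr rfl fun j _ => by ring

theorem conjTranspose_mul_spectralMatrix_mul (U W : Matrix n n ℂ) (d : n → ℝ) :
    Uᴴ * spectralMatrix W d * U = spectralMatrix (Uᴴ * W) d := by
  simp only [spectralMatrix, conjTranspose_mul, conjTranspose_conjTranspose, Matrix.mul_assoc]

theorem spectralMatrix_const {W : Matrix n n ℂ} (hW : W ∈ unitaryGroup n ℂ) (c : ℝ) :
    spectralMatrix W (fun _ => c) = (c : ℂ) • 1 := by
  rw [spectralMatrix, ← smul_one_eq_diagonal, Matrix.mul_smul, Matrix.smul_mul, Matrix.mul_one,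
    ← star_eq_conjTranspose, mem_unitaryGroup_iff.mp hW]

theorem spectralMatrix_kronecker {m : Type*} [Fintype m] [DecidableEq m]
    (U : Matrix m m ℂ) (V : Matrix n n ℂ) (α : m → ℝ) (β : n → ℝ) :
    spectralMatrix U α ⊗ₖ spectralMatrix V β =
      spectralMatrix (U ⊗ₖ V) fun x => α x.1 * β x.2 := by
  simp only [spectralMatrix, mul_kronecker_mul, conjTranspose_kronecker,
    diagonal_kronecker_diagonal, Complex.ofReal_mul]

theorem dotProduct_spectralMatrix_mulVec (W : Matrix n n ℂ) (d : n → ℝ) (v : n → ℂ) :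
    star v ⬝ᵥ (spectralMatrix W d *ᵥ v) = ((∑ x, d x * ‖(Wᴴ *ᵥ v) x‖ ^ 2 : ℝ) : ℂ) := by
  calc star v ⬝ᵥ (spectralMatrix W d *ᵥ v)
      = star (Wᴴ *ᵥ v) ⬝ᵥ (diagonal (fun x => (d x : ℂ)) *ᵥ (Wᴴ *ᵥ v)) := by
        rw [spectralMatrix, star_mulVec, conjTranspose_conjTranspose, ← dotProduct_mulVec,
          mulVec_mulVec, mulVec_mulVec, Matrix.mul_assoc]
    _ = ((∑ x, d x * ‖(Wᴴ *ᵥ v) x‖ ^ 2 : ℝ) : ℂ) := by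
        simp only [dotProduct, mulVec_diagonal, Pi.star_apply, Complex.ofReal_sum,
          Complex.ofReal_mul, Complex.ofReal_pow, ← Complex.mul_conj', RCLike.star_def]
        exact sum_congr rfl fun x _ => by ring

theorem spectralMatrix_submatrix_equiv (W : Matrix n n ℂ) (d : n → ℝ) (σ : Equiv.Perm n) :
    spectralMatrix (W.submatrix id σ) (d ∘ σ) = spectralMatrix W d := by
  have hdiag : diagonal (fun i => ((d ∘ σ) i : ℂ)) =
      (diagonal fun i => (d i : ℂ)).submatrix σ σ :=
    (submatrix_diagonal_equiv (fun i => (d i : ℂ)) σ).symm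
  rw [spectralMatrix, spectralMatrix, hdiag, conjTranspose_submatrix, submatrix_mul_equiv,
    submatrix_mul_equiv, submatrix_id_id]

theorem submatrix_equiv_mem_unitaryGroup {W : Matrix n n ℂ} (hW : W ∈ unitaryGroup n ℂ)
    (σ : Equiv.Perm n) : W.submatrix id σ ∈ unitaryGroup n ℂ := by
  rw [mem_unitaryGroup_iff, star_eq_conjTranspose, conjTranspose_submatrix, submatrix_mul_equiv,
    submatrix_id_id, ← star_eq_conjTranspose, mem_unitaryGroup_iff.mp hW]

theorem conjTranspose_mul_mul_eq_one_iff {W X : Matrix n n ℂ} (hW : W ∈ unitaryGroup n ℂ) :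
    Wᴴ * X * W = 1 ↔ X = 1 := by
  have hW₁ : Wᴴ * W = 1 := mem_unitaryGroup_iff'.mp hW
  have hW₂ : W * Wᴴ = 1 := mem_unitaryGroup_iff.mp hW
  refine ⟨fun h => ?_, fun h => by rw [h, Matrix.mul_one, hW₁]⟩
  calc X = W * Wᴴ * X * (W * Wᴴ) := by rw [hW₂, Matrix.one_mul, Matrix.mul_one]
    _ = W * (Wᴴ * X * W) * Wᴴ := by simp only [Matrix.mul_assoc]
    _ = 1 := by rw [h, Matrix.mul_one, hW₂]

theorem permMatrix_mem_unitaryGroup (σ : Equiv.Perm n) :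
    σ.permMatrix ℂ ∈ unitaryGroup n ℂ := by
  rw [mem_unitaryGroup_iff, star_eq_conjTranspose, conjTranspose_permMatrix, ← permMatrix_mul,
    inv_mul_cancel, permMatrix_one]

theorem eq_spectralMatrix_eigenvalues {K : Matrix n n ℂ} (hK : K.IsHermitian) :
    K = spectralMatrix hK.eigenvectorUnitary hK.eigenvalues := by
  conv_lhs => rw [hK.spectral_theorem, Unitary.conjStarAlgAut_apply]
  rfl

end UnitaryMatrices

/-! ### Populations and von Neumann entropy -/

section Populations

open Matrix

variable {n : Type*} [Fintype n] [DecidableEq n] {U ρ : Matrix n n ℂ}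

/-- The diagonal of `ρ` in the basis formed by the columns of `U`. -/
noncomputable def populations (U ρ : Matrix n n ℂ) (i : n) : ℝ :=
  ((Uᴴ * ρ * U) i i).re

omit [DecidableEq n] in
theorem populations_nonneg (U : Matrix n n ℂ) (hρ : ρ.PosSemidef) (i : n) :
    0 ≤ populations U ρ i :=
  (Complex.nonneg_iff.mp (hρ.conjTranspose_mul_mul_same U).diag_nonneg).1

theorem sum_populations (hU : U ∈ unitaryGroup n ℂ) (ρ : Matrix n n ℂ) :
    ∑ i, populations U ρ i = ρ.trace.re := by
  calc ∑ i, populations U ρ i = (Uᴴ * ρ * U).trace.re := (map_sum Complex.reAddGroupHom _ _).symm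
    _ = ρ.trace.re := by
        rw [trace_mul_cycle, ← star_eq_conjTranspose, mem_unitaryGroup_iff.mp hU, Matrix.one_mul]

theorem populations_mem_stdSimplex (hU : U ∈ unitaryGroup n ℂ) (hρ : ρ.PosSemidef)
    (htrace : ρ.trace = 1) : populations U ρ ∈ stdSimplex ℝ n :=
  ⟨populations_nonneg U hρ, by rw [sum_populations hU, htrace, Complex.one_re]⟩

theorem populations_spectralMatrix (U W : Matrix n n ℂ) (d : n → ℝ) :
    populations U (spectralMatrix W d) = transitionMatrix (Uᴴ * W) *ᵥ d := by
  ext i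
  rw [populations, conjTranspose_mul_spectralMatrix_mul, spectralMatrix_apply_self,
    Complex.ofReal_re]

theorem populations_eigenvectorUnitary (hρ : ρ.IsHermitian) :
    populations hρ.eigenvectorUnitary ρ = hρ.eigenvalues := by
  have hdiag := hρ.conjStarAlgAut_star_eigenvectorUnitary
  rw [Unitary.conjStarAlgAut_star_apply, star_eq_conjTranspose] at hdiag
  ext i
  rw [populations, hdiag]
  simp

theorem eigenvalues_mem_stdSimplex (hρ : ρ.PosSemidef) (htrace : ρ.trace = 1) :
    hρ.isHermitian.eigenvalues ∈ stdSimplex ℝ n := by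
  rw [← populations_eigenvectorUnitary]
  exact populations_mem_stdSimplex (Subtype.prop _) hρ htrace

theorem shannonEntropy_eigenvalues_le_shannonEntropy_populations (hU : U ∈ unitaryGroup n ℂ)
    (hρ : ρ.PosSemidef) :
    shannonEntropy hρ.isHermitian.eigenvalues ≤ shannonEntropy (populations U ρ) := by
  have hW := mul_mem (Unitary.star_mem hU) hρ.isHermitian.eigenvectorUnitary.2
  nth_rw 3 [eq_spectralMatrix_eigenvalues hρ.isHermitian]
  rw [populations_spectralMatrix]
  exact shannonEntropy_le_shannonEntropy_mulVec (transitionMatrix_mem_doublyStochastic hW)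
    hρ.eigenvalues_nonneg

theorem log_card_le_shannonEntropy_eigenvalues_iff [Nonempty n] (hρ : ρ.PosSemidef)
    (htrace : ρ.trace = 1) :
    log (Fintype.card n) ≤ shannonEntropy hρ.isHermitian.eigenvalues ↔
      ρ = (Fintype.card n : ℂ)⁻¹ • 1 := by
  have hW := hρ.isHermitian.eigenvectorUnitary.2
  rw [log_card_le_shannonEntropy_iff (eigenvalues_mem_stdSimplex hρ htrace)]
  constructor <;> intro h
  · rw [eq_spectralMatrix_eigenvalues hρ.isHermitian, h, uniformOn_univ]
    simpa using spectralMatrix_const hW (Fintype.card n : ℝ)⁻¹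
  · calc hρ.isHermitian.eigenvalues
        = populations hρ.isHermitian.eigenvectorUnitary ρ :=
          (populations_eigenvectorUnitary hρ.isHermitian).symm
      _ = populations hρ.isHermitian.eigenvectorUnitary ((Fintype.card n : ℂ)⁻¹ • 1) :=
          congrArg (populations _) h
      _ = uniformOn univ := by
          ext i
          simp [populations, ← star_eq_conjTranspose, mem_unitaryGroup_iff'.mp hW, uniformOn_univ]

end Populations

/-! ### Bipartite pure states -/

section BipartiteStates

open Matrix

variable {U V : Matrix (Fin N) (Fin N) ℂ} {ψ : EuclideanSpace ℂ (Fin N × Fin N)} {s t : ℝ}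

/-- The matrix of coefficients of a bipartite vector in the standard product basis. -/
noncomputable def coeffMatrix (ψ : EuclideanSpace ℂ (Fin N × Fin N)) : Matrix (Fin N) (Fin N) ℂ :=
  of fun i k => ψ (i, k)

/-- The reduced state `Tr_B |ψ⟩⟨ψ|` of the first subsystem. -/
noncomputable abbrev reducedState (ψ : EuclideanSpace ℂ (Fin N × Fin N)) :
    Matrix (Fin N) (Fin N) ℂ :=
  partialTraceB (pureDensity ψ)

theorem reducedState_eq (ψ : EuclideanSpace ℂ (Fin N × Fin N)) :
    reducedState ψ = coeffMatrix ψ * (coeffMatrix ψ)ᴴ := by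
  ext
  simp [partialTraceB, pureDensity, coeffMatrix, mul_apply]

theorem reducedState_posSemidef (ψ : EuclideanSpace ℂ (Fin N × Fin N)) :
    (reducedState ψ).PosSemidef :=
  reducedState_eq ψ ▸ posSemidef_self_mul_conjTranspose (coeffMatrix ψ)

theorem trace_reducedState (ψ : EuclideanSpace ℂ (Fin N × Fin N)) :
    (reducedState ψ).trace = ((‖ψ‖ ^ 2 : ℝ) : ℂ) := by
  rw [EuclideanSpace.norm_sq_eq, Fintype.sum_prod_type]
  simp [trace, partialTraceB, pureDensity, Complex.mul_conj']

theorem trace_reducedState_of_norm_eq_one (hψ : ‖ψ‖ = 1) : (reducedState ψ).trace = 1 := by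
  rw [trace_reducedState, hψ, one_pow, Complex.ofReal_one]

theorem entanglementEntropy_eq_shannonEntropy (ψ : EuclideanSpace ℂ (Fin N × Fin N)) :
    entanglementEntropy ψ =
      shannonEntropy (reducedState_posSemidef ψ).isHermitian.eigenvalues :=
  rfl

theorem mem_entangledStates_zero_iff : ψ ∈ entangledStates N 0 ↔ ‖ψ‖ = 1 :=
  and_iff_left_of_imp fun hψ => shannonEntropy_nonneg
    (eigenvalues_mem_stdSimplex (reducedState_posSemidef ψ) (trace_reducedState_of_norm_eq_one hψ))

theorem entangledStates_antitone : Antitone (entangledStates N) :=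
  fun _ _ hst _ hψ => ⟨hψ.1, hst.trans hψ.2⟩

theorem populations_reducedState_mem_entropicSimplex (hU : U ∈ unitaryGroup (Fin N) ℂ)
    (hψ : ψ ∈ entangledStates N s) : populations U (reducedState ψ) ∈ entropicSimplex N s :=
  ⟨populations_mem_stdSimplex hU (reducedState_posSemidef ψ)
      (trace_reducedState_of_norm_eq_one hψ.1),
    hψ.2.trans (shannonEntropy_eigenvalues_le_shannonEntropy_populations hU
      (reducedState_posSemidef ψ))⟩

theorem continuous_populations_reducedState (U : Matrix (Fin N) (Fin N) ℂ) :
    Continuous fun ψ : EuclideanSpace ℂ (Fin N × Fin N) => populations U (reducedState ψ) := by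
  have hcoeff : Continuous (coeffMatrix (N := N)) :=
    continuous_matrix fun i k => PiLp.continuous_apply 2 _ (i, k)
  simp only [reducedState_eq]
  unfold populations
  fun_prop

theorem isCompact_entangledStates (N : ℕ) (s : ℝ) : IsCompact (entangledStates N s) := by
  -- The entanglement entropy is the minimum over all bases of the entropy of the populations, so
  -- its superlevel sets are intersections of closed sets.
  have hinter : entangledStates N s = Metric.sphere 0 1 ∩ ⋂ U : unitaryGroup (Fin N) ℂ,
      {ψ | s ≤ shannonEntropy (populations U (reducedState ψ))} := by
    ext ψ
    simp only [entangledStates, Set.mem_ofPred_eq, Set.mem_inter_iff, mem_sphere_zero_iff_norm,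
      Set.mem_iInter]
    refine and_congr_right fun hψ => ⟨fun h U => ?_, fun h => ?_⟩
    · exact (populations_reducedState_mem_entropicSimplex U.2 ⟨hψ, h⟩).2
    · rw [entanglementEntropy_eq_shannonEntropy, ← populations_eigenvectorUnitary]
      exact h (reducedState_posSemidef ψ).isHermitian.eigenvectorUnitary
  have hclosed (U : unitaryGroup (Fin N) ℂ) :
      IsClosed {ψ | s ≤ shannonEntropy (populations U.1 (reducedState ψ))} :=
    isClosed_le continuous_const
      (continuous_shannonEntropy.comp (continuous_populations_reducedState U.1))
  exact hinter ▸ (isCompact_sphere 0 1).inter_right (isClosed_iInter hclosed)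

/-! ### Amplitudes in a product basis -/

/-- The coefficient matrix of `ψ` in the product of the bases formed by the columns of `U` and
of `V`. -/
noncomputable def amplitudes (U V : Matrix (Fin N) (Fin N) ℂ)
    (ψ : EuclideanSpace ℂ (Fin N × Fin N)) : Matrix (Fin N) (Fin N) ℂ :=
  Uᴴ * coeffMatrix ψ * Vᴴᵀ

/-- The bipartite vector `∑ i j, D i j • (u_i ⊗ v_j)`, where `u_i` and `v_j` are the columns of `U`
and `V`. -/
noncomputable def ofAmplitudes (U V D : Matrix (Fin N) (Fin N) ℂ) :
    EuclideanSpace ℂ (Fin N × Fin N) :=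
  WithLp.toLp 2 fun x => (U * D * Vᵀ) x.1 x.2

theorem amplitudes_ofAmplitudes (hU : U ∈ unitaryGroup (Fin N) ℂ)
    (hV : V ∈ unitaryGroup (Fin N) ℂ) (D : Matrix (Fin N) (Fin N) ℂ) :
    amplitudes U V (ofAmplitudes U V D) = D := by
  have hU' : Uᴴ * U = 1 := mem_unitaryGroup_iff'.mp hU
  have hV' : Vᵀ * Vᴴᵀ = 1 := by
    rw [← transpose_mul, ← star_eq_conjTranspose, mem_unitaryGroup_iff'.mp hV, transpose_one]
  calc Uᴴ * (U * D * Vᵀ) * Vᴴᵀ = Uᴴ * U * D * (Vᵀ * Vᴴᵀ) := by simp only [Matrix.mul_assoc]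
    _ = D := by rw [hU', hV', Matrix.one_mul, Matrix.mul_one]

theorem amplitudes_mul_conjTranspose (U : Matrix (Fin N) (Fin N) ℂ)
    (hV : V ∈ unitaryGroup (Fin N) ℂ) (ψ : EuclideanSpace ℂ (Fin N × Fin N)) :
    amplitudes U V ψ * (amplitudes U V ψ)ᴴ = Uᴴ * reducedState ψ * U := by
  have hV' : Vᴴᵀ * Vᵀ = 1 := by
    rw [← transpose_mul, ← star_eq_conjTranspose, mem_unitaryGroup_iff.mp hV, transpose_one]
  calc amplitudes U V ψ * (amplitudes U V ψ)ᴴ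
      = Uᴴ * (coeffMatrix ψ * (Vᴴᵀ * Vᵀ) * (coeffMatrix ψ)ᴴ) * U := by
        simp only [amplitudes, conjTranspose_mul, conjTranspose_conjTranspose,
          conjTranspose_transpose_eq_transpose_conjTranspose, Matrix.mul_assoc]
    _ = Uᴴ * reducedState ψ * U := by rw [hV', Matrix.mul_one, reducedState_eq]

theorem populations_reducedState (U : Matrix (Fin N) (Fin N) ℂ)
    (hV : V ∈ unitaryGroup (Fin N) ℂ) (ψ : EuclideanSpace ℂ (Fin N × Fin N)) (i : Fin N) :
    populations U (reducedState ψ) i = ∑ j, transitionMatrix (amplitudes U V ψ) i j := by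
  rw [populations, ← amplitudes_mul_conjTranspose U hV, mul_conjTranspose_self_apply_self,
    Complex.ofReal_re]

theorem norm_sq_eq_sum_transitionMatrix_amplitudes (hU : U ∈ unitaryGroup (Fin N) ℂ)
    (hV : V ∈ unitaryGroup (Fin N) ℂ) (ψ : EuclideanSpace ℂ (Fin N × Fin N)) :
    ‖ψ‖ ^ 2 = ∑ i, ∑ j, transitionMatrix (amplitudes U V ψ) i j := by
  simp only [← populations_reducedState U hV, sum_populations hU, trace_reducedState,
    Complex.ofReal_re]

theorem mem_entangledStates_log_iff_reducedState [NeZero N] :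
    ψ ∈ entangledStates N (log N) ↔ reducedState ψ = (N : ℂ)⁻¹ • 1 := by
  have hiff (hψ : ‖ψ‖ = 1) :=
    log_card_le_shannonEntropy_eigenvalues_iff (reducedState_posSemidef ψ)
      (trace_reducedState_of_norm_eq_one hψ)
  simp only [Fintype.card_fin] at hiff
  refine ⟨fun h => (hiff h.1).mp h.2, fun h => ?_⟩
  have hnorm : ‖ψ‖ = 1 := by
    have htrace := trace_reducedState ψ
    rw [h, trace_smul, trace_one, Fintype.card_fin, smul_eq_mul,
      inv_mul_cancel₀ (NeZero.ne (N : ℂ))] at htrace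
    exact (pow_eq_one_iff_of_nonneg (norm_nonneg ψ) two_ne_zero).mp (by exact_mod_cast htrace.symm)
  exact ⟨hnorm, (hiff hnorm).mpr h⟩

theorem mem_entangledStates_log_iff [NeZero N] (hU : U ∈ unitaryGroup (Fin N) ℂ)
    (hV : V ∈ unitaryGroup (Fin N) ℂ) : ψ ∈ entangledStates N (log N) ↔
      ((√N : ℝ) : ℂ) • amplitudes U V ψ ∈ unitaryGroup (Fin N) ℂ := by
  have hN : (N : ℂ) ≠ 0 := NeZero.ne _
  have hsqrt : ((√N : ℝ) : ℂ) * ((√N : ℝ) : ℂ) = N := by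
    exact_mod_cast Real.mul_self_sqrt N.cast_nonneg
  have hgram : (((√N : ℝ) : ℂ) • amplitudes U V ψ) * (((√N : ℝ) : ℂ) • amplitudes U V ψ)ᴴ =
      Uᴴ * ((N : ℂ) • reducedState ψ) * U := by
    rw [conjTranspose_smul, RCLike.star_def, Complex.conj_ofReal, Matrix.smul_mul,
      Matrix.mul_smul, smul_smul, hsqrt, amplitudes_mul_conjTranspose U hV, Matrix.mul_smul,
      Matrix.smul_mul]
  rw [mem_entangledStates_log_iff_reducedState, mem_unitaryGroup_iff, star_eq_conjTranspose,
    hgram, conjTranspose_mul_mul_eq_one_iff hU, eq_inv_smul_iff₀ hN]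

theorem ofAmplitudes_mem_entangledStates_log [NeZero N] (hU : U ∈ unitaryGroup (Fin N) ℂ)
    (hV : V ∈ unitaryGroup (Fin N) ℂ) {W : Matrix (Fin N) (Fin N) ℂ}
    (hW : W ∈ unitaryGroup (Fin N) ℂ) :
    ofAmplitudes U V (((√N : ℝ) : ℂ)⁻¹ • W) ∈ entangledStates N (log N) := by
  have hsqrt : ((√N : ℝ) : ℂ) ≠ 0 := by simp [NeZero.ne N]
  rwa [mem_entangledStates_log_iff hU hV, amplitudes_ofAmplitudes hU hV, smul_inv_smul₀ hsqrt]

/-! ### Energy -/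

theorem continuous_energy (K : Matrix (Fin N × Fin N) (Fin N × Fin N) ℂ) :
    Continuous (energy K) := by
  unfold energy dotProduct mulVec dotProduct
  simp only [Pi.star_apply]
  fun_prop

theorem entangledStates_nonempty [NeZero N] (hs : s ≤ log N) : (entangledStates N s).Nonempty :=
  ⟨_, entangledStates_antitone hs
    (ofAmplitudes_mem_entangledStates_log (one_mem _) (one_mem _) (one_mem _))⟩

theorem isLeast_Jmin [NeZero N] (K : Matrix (Fin N × Fin N) (Fin N × Fin N) ℂ) (hs : s ≤ log N) :
    IsLeast (energy K '' entangledStates N s) (Jmin K s) :=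
  ((isCompact_entangledStates N s).image (continuous_energy K)).isLeast_sInf
    ((entangledStates_nonempty hs).image _)

theorem Jmin_le_Jmin [NeZero N] (K : Matrix (Fin N × Fin N) (Fin N × Fin N) ℂ) (hts : t ≤ s)
    (hs : s ≤ log N) : Jmin K t ≤ Jmin K s :=
  (isLeast_Jmin K hs).mono (isLeast_Jmin K (hts.trans hs))
    (Set.image_mono (entangledStates_antitone hts))

theorem conjTranspose_kronecker_mulVec (U V : Matrix (Fin N) (Fin N) ℂ)
    (ψ : EuclideanSpace ℂ (Fin N × Fin N)) (x : Fin N × Fin N) :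
    ((U ⊗ₖ V)ᴴ *ᵥ ψ.ofLp) x = amplitudes U V ψ x.1 x.2 := by
  rw [conjTranspose_kronecker]
  calc ((Uᴴ ⊗ₖ Vᴴ) *ᵥ vec (coeffMatrix ψ)ᵀ) x = (Vᴴ * (coeffMatrix ψ)ᵀ * Uᴴᵀ)ᵀ x.1 x.2 := by
        rw [kronecker_mulVec_vec]
        rfl
    _ = amplitudes U V ψ x.1 x.2 := by
        simp only [amplitudes, transpose_mul, transpose_transpose, Matrix.mul_assoc]

theorem energy_kronecker_spectralMatrix (U V : Matrix (Fin N) (Fin N) ℂ) (α β : Fin N → ℝ)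
    (ψ : EuclideanSpace ℂ (Fin N × Fin N)) :
    energy (spectralMatrix U α ⊗ₖ spectralMatrix V β) ψ =
      α ⬝ᵥ (transitionMatrix (amplitudes U V ψ) *ᵥ β) := by
  rw [energy, spectralMatrix_kronecker, dotProduct_spectralMatrix_mulVec, Complex.ofReal_re,
    Fintype.sum_prod_type]
  simp only [conjTranspose_kronecker_mulVec]
  simp only [dotProduct, mulVec, mul_sum, transitionMatrix, map_apply]
  exact sum_congr rfl fun i _ => sum_congr rfl fun j _ => by ring

end BipartiteStates

/-! ### Product observables -/

section ProductObservables

open Matrix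

variable {U V : Matrix (Fin N) (Fin N) ℂ} {α β : Fin N → ℝ} {i₀ k₀ : Fin N} {s : ℝ}

theorem sum_mul_populations_le_energy (hV : V ∈ unitaryGroup (Fin N) ℂ) (hα : ∀ i, 0 ≤ α i)
    (hβ : ∀ k, β k₀ ≤ β k) (ψ : EuclideanSpace ℂ (Fin N × Fin N)) :
    ∑ i, α i * β k₀ * populations U (reducedState ψ) i ≤
      energy (spectralMatrix U α ⊗ₖ spectralMatrix V β) ψ := by
  simp only [energy_kronecker_spectralMatrix, populations_reducedState U hV, mulVec, dotProduct,
    mul_assoc, mul_sum (a := β k₀)]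
  refine sum_le_sum fun i _ => mul_le_mul_of_nonneg_left (sum_le_sum fun k _ => ?_) (hα i)
  rw [mul_comm]
  exact mul_le_mul_of_nonneg_left (hβ k) (sq_nonneg _)

theorem relaxedJmin_le_energy (hU : U ∈ unitaryGroup (Fin N) ℂ) (hV : V ∈ unitaryGroup (Fin N) ℂ)
    (hα : ∀ i, 0 ≤ α i) (hβ : ∀ k, β k₀ ≤ β k) {ψ : EuclideanSpace ℂ (Fin N × Fin N)}
    (hψ : ψ ∈ entangledStates N s) :
    relaxedJmin (fun i => α i * β k₀) s ≤
      energy (spectralMatrix U α ⊗ₖ spectralMatrix V β) ψ :=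
  (csInf_le ((isCompact_entropicSimplex N s).image (by fun_prop)).bddBelow
    (Set.mem_image_of_mem _ (populations_reducedState_mem_entropicSimplex hU hψ))).trans
    (sum_mul_populations_le_energy hV hα hβ ψ)

theorem relaxedJmin_le_Jmin [NeZero N] (hU : U ∈ unitaryGroup (Fin N) ℂ)
    (hV : V ∈ unitaryGroup (Fin N) ℂ) (hα : ∀ i, 0 ≤ α i) (hβ : ∀ k, β k₀ ≤ β k)
    (hs : s ≤ log N) :
    relaxedJmin (fun i => α i * β k₀) s ≤ Jmin (spectralMatrix U α ⊗ₖ spectralMatrix V β) s := by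
  obtain ⟨ψ, hψ, henergy⟩ := (isLeast_Jmin (spectralMatrix U α ⊗ₖ spectralMatrix V β) hs).1
  exact (relaxedJmin_le_energy hU hV hα hβ hψ).trans_eq henergy

theorem sigmaMin_kronecker_spectralMatrix (hU : U ∈ unitaryGroup (Fin N) ℂ)
    (hV : V ∈ unitaryGroup (Fin N) ℂ) (hα : ∀ i, 0 ≤ α i) (hβ : ∀ k, β k₀ ≤ β k)
    (hmin : ∀ i, α i₀ * β k₀ ≤ α i * β k₀) :
    sigmaMin (spectralMatrix U α ⊗ₖ spectralMatrix V β) = α i₀ * β k₀ := by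
  refine IsLeast.csInf_eq ⟨⟨ofAmplitudes U V (single i₀ k₀ 1), ?_, ?_⟩, ?_⟩
  · rw [mem_entangledStates_zero_iff, ← pow_eq_one_iff_of_nonneg (norm_nonneg _) two_ne_zero,
      norm_sq_eq_sum_transitionMatrix_amplitudes hU hV, amplitudes_ofAmplitudes hU hV,
      transitionMatrix_single]
    simp [single_apply, ite_and]
  · rw [energy_kronecker_spectralMatrix, amplitudes_ofAmplitudes hU hV, transitionMatrix_single,
      single_mulVec]
    simp [dotProduct, Function.update_apply]
  · rintro _ ⟨ψ, hψ, rfl⟩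
    rw [← relaxedJmin_eq_of_le_log_card (i₀ := i₀) (μ := fun i => α i * β k₀) hmin
      (log_natCast_nonneg _)]
    exact relaxedJmin_le_energy hU hV hα hβ hψ

theorem Jmin_log_kronecker_spectralMatrix [NeZero N] (hU : U ∈ unitaryGroup (Fin N) ℂ)
    (hV : V ∈ unitaryGroup (Fin N) ℂ) (hα : Antitone α) (hβ : Antitone β) :
    Jmin (spectralMatrix U α ⊗ₖ spectralMatrix V β) (log N) =
      1 / N * ∑ i, α i * β (Fin.rev i) := by
  have hsqrt : ‖((√N : ℝ) : ℂ)‖ ^ 2 = N := by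
    rw [Complex.norm_real, norm_eq_abs, sq_abs, sq_sqrt N.cast_nonneg]
  have hanti : Antivary α (β ∘ Fin.revPerm) :=
    hα.antivary fun i j h => hβ (Fin.rev_le_rev.mpr h)
  have henergy (W : Matrix (Fin N) (Fin N) ℂ) :
      α ⬝ᵥ (transitionMatrix (((√N : ℝ) : ℂ)⁻¹ • W) *ᵥ β) =
        1 / N * (α ⬝ᵥ (transitionMatrix W *ᵥ β)) := by
    rw [transitionMatrix_smul, norm_inv, inv_pow, hsqrt, smul_mulVec, dotProduct_smul, smul_eq_mul,
      one_div]
  change _ = 1 / N * (α ⬝ᵥ (β ∘ Fin.revPerm))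
  refine IsLeast.csInf_eq ⟨⟨_, ofAmplitudes_mem_entangledStates_log hU hV
    (permMatrix_mem_unitaryGroup Fin.revPerm), ?_⟩, ?_⟩
  · rw [energy_kronecker_spectralMatrix, amplitudes_ofAmplitudes hU hV, henergy,
      transitionMatrix_permMatrix, permMatrix_mulVec]
  · rintro _ ⟨ψ, hψ, rfl⟩
    have hunitary := (mem_entangledStates_log_iff hU hV).mp hψ
    rw [energy_kronecker_spectralMatrix,
      ← inv_smul_smul₀ (a := ((√N : ℝ) : ℂ)) (by simp [NeZero.ne N]) (amplitudes U V ψ), henergy]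
    exact mul_le_mul_of_nonneg_left (dotProduct_le_dotProduct_mulVec_of_mem_doublyStochastic hanti
      (transitionMatrix_mem_doublyStochastic hunitary)) (by positivity)

end ProductObservables

/-! ### Sorted eigenvalues -/

section SortedEigenvalues

open Matrix

variable {K : Matrix (Fin N) (Fin N) ℂ}

theorem sortedEigenvalues_antitone (hK : K.IsHermitian) : Antitone (sortedEigenvalues hK) :=
  fun _ _ h => hK.eigenvalues₀_antitone (Fin.cast_le_cast _ |>.mpr h)

theorem exists_perm_sortedEigenvalues_eq (hK : K.IsHermitian) :
    ∃ σ : Equiv.Perm (Fin N), sortedEigenvalues hK = hK.eigenvalues ∘ σ :=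
  ⟨(finCongr (Fintype.card_fin N).symm).trans (Fintype.equivOfCardEq (Fintype.card_fin _)),
    funext fun i => by simp [sortedEigenvalues, IsHermitian.eigenvalues]⟩

theorem sortedEigenvalues_nonneg (hK : K.PosSemidef) (i : Fin N) :
    0 ≤ sortedEigenvalues hK.isHermitian i := by
  obtain ⟨σ, hσ⟩ := exists_perm_sortedEigenvalues_eq hK.isHermitian
  exact hσ ▸ hK.eigenvalues_nonneg (σ i)

theorem exists_eq_spectralMatrix_sortedEigenvalues (hK : K.IsHermitian) :
    ∃ U ∈ unitaryGroup (Fin N) ℂ, K = spectralMatrix U (sortedEigenvalues hK) := by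
  obtain ⟨σ, hσ⟩ := exists_perm_sortedEigenvalues_eq hK
  refine ⟨_, submatrix_equiv_mem_unitaryGroup hK.eigenvectorUnitary.2 σ, ?_⟩
  rw [hσ, spectralMatrix_submatrix_equiv]
  exact eq_spectralMatrix_eigenvalues hK

theorem localObservable_posSemidef {O : Type*} [Fintype O] (E : Channel N) (M : POVM N O) (a : O) :
    (localObservable E M a).PosSemidef :=
  posSemidef_sum _ fun k _ => (M.posSemidef a).conjTranspose_mul_mul_same (E.kraus k)

end SortedEigenvalues

end QPrivacy

open QPrivacy in
theorem mainTheorem3_general {N : ℕ} [NeZero N] {A B : Matrix (Fin N) (Fin N) ℂ}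
    (hA : A.PosSemidef) (hB : B.PosSemidef)
    (K : Matrix (Fin N × Fin N) (Fin N × Fin N) ℂ) (hK : K = Matrix.kronecker A B)
    (α β μ : Fin N → ℝ)
    (hα : α = sortedEigenvalues hA.isHermitian) (hβ : β = sortedEigenvalues hB.isHermitian)
    (hμ : ∀ i, μ i = α i * β (Fin.rev 0))
    (dmin : ℕ) (hdmin : dmin = (Finset.univ.filter fun j => μ j = μ (Fin.rev 0)).card)
    (s : ℝ) (hs : s ≤ Real.log N) :
    IsLeast (energy K '' entangledStates N s) (Jmin K s) ∧
    IsLeast ((fun p : Fin N → ℝ => ∑ j, μ j * p j) '' entropicSimplex N s) (relaxedJmin μ s) ∧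
    μ (Fin.rev 0) = sigmaMin K ∧
    relaxedJmin μ s ≤ Jmin K s ∧
    (s ≤ Real.log dmin → relaxedJmin μ s = sigmaMin K) ∧
    (Real.log dmin < s →
      ∃ γ : ℝ, 0 ≤ γ ∧ (s < Real.log N → 0 < γ) ∧
        Real.log (partitionFn μ γ) + γ * gibbsAverage μ γ = s ∧
        (∀ γ' : ℝ, 0 ≤ γ' →
          Real.log (partitionFn μ γ') + γ' * gibbsAverage μ γ' = s → γ' = γ) ∧
        relaxedJmin μ s = gibbsAverage μ γ ∧
        sigmaMin K < relaxedJmin μ s) ∧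
    (s = Real.log N →
      Jmin K s = (1 / (N : ℝ)) * ∑ i, α i * β (Fin.rev i) ∧
      relaxedJmin μ s = (1 / (N : ℝ)) * ∑ i, μ i ∧
      ∀ t : ℝ, t ≤ Real.log N → Jmin K t ≤ Jmin K s) := by
  obtain ⟨U, hU, hAU⟩ := exists_eq_spectralMatrix_sortedEigenvalues hA.isHermitian
  obtain ⟨V, hV, hBV⟩ := exists_eq_spectralMatrix_sortedEigenvalues hB.isHermitian
  have hα_nonneg (i : Fin N) : 0 ≤ α i := hα ▸ sortedEigenvalues_nonneg hA i
  have hα_anti : Antitone α := hα ▸ sortedEigenvalues_antitone hA.isHermitian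
  have hβ_anti : Antitone β := hβ ▸ sortedEigenvalues_antitone hB.isHermitian
  have hβ_last (k : Fin N) : β (Fin.rev 0) ≤ β k := hβ_anti (Fin.le_rev_iff.mpr (Fin.zero_le _))
  have hβ_last_nonneg : 0 ≤ β (Fin.rev 0) := hβ ▸ sortedEigenvalues_nonneg hB _
  have hmin (i : Fin N) : α (Fin.rev 0) * β (Fin.rev 0) ≤ α i * β (Fin.rev 0) :=
    mul_le_mul_of_nonneg_right (hα_anti (Fin.le_rev_iff.mpr (Fin.zero_le _))) hβ_last_nonneg
  have hσ := sigmaMin_kronecker_spectralMatrix hU hV hα_nonneg hβ_last hmin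
  obtain rfl : μ = fun i => α i * β (Fin.rev 0) := funext hμ
  obtain rfl : K = spectralMatrix U α ⊗ₖ spectralMatrix V β := by
    rw [hK, hα, hβ, ← hAU, ← hBV]
    rfl
  subst hdmin
  refine ⟨isLeast_Jmin _ hs, isLeast_relaxedJmin _ hs, hσ.symm,
    relaxedJmin_le_Jmin hU hV hα_nonneg hβ_last hs,
    fun hlow => (relaxedJmin_eq_of_le_log_card hmin hlow).trans hσ.symm,
    fun hhigh => hσ ▸ exists_relaxedJmin_eq_gibbsAverage hmin hhigh hs, ?_⟩
  rintro rfl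
  exact ⟨Jmin_log_kronecker_spectralMatrix hU hV hα_anti hβ_anti, relaxedJmin_log _,
    fun t ht => Jmin_le_Jmin _ ht le_rfl⟩

open QPrivacy in
theorem mainTheorem3 {N : ℕ} [NeZero N] {OA OB : Type*} [Fintype OA] [Fintype OB]
    (EA EB : Channel N) (MA : POVM N OA) (MB : POVM N OB) (a : OA) (b : OB)
    (K : Matrix (Fin N × Fin N) (Fin N × Fin N) ℂ)
    (hK : K = Matrix.kronecker (localObservable EA MA a) (localObservable EB MB b))
    (α β μ : Fin N → ℝ)
    (hα : α = sortedEigenvalues (localObservable_isHermitian EA MA a))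
    (hβ : β = sortedEigenvalues (localObservable_isHermitian EB MB b))
    -- `Fin.rev 0` is the last index; `Fin.rev i` is the index `N - i + 1` in one-based counting
    (hμ : ∀ i, μ i = α i * β (Fin.rev 0))
    (dmin : ℕ) (hdmin : dmin = (Finset.univ.filter fun j => μ j = μ (Fin.rev 0)).card)
    (s : ℝ) (hs : s ≤ Real.log N) :
    -- both minima are attained, and the lowest level is the unconstrained minimal energy
    IsLeast (energy K '' entangledStates N s) (Jmin K s) ∧
    IsLeast ((fun p : Fin N → ℝ => ∑ j, μ j * p j) '' entropicSimplex N s) (relaxedJmin μ s) ∧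
    μ (Fin.rev 0) = sigmaMin K ∧
    -- the relaxed value is a lower bound
    relaxedJmin μ s ≤ Jmin K s ∧
    -- low-entanglement regime
    (s ≤ Real.log dmin → relaxedJmin μ s = sigmaMin K) ∧
    -- high-entanglement regime
    (Real.log dmin < s →
      ∃ γ : ℝ, 0 ≤ γ ∧ (s < Real.log N → 0 < γ) ∧
        Real.log (partitionFn μ γ) + γ * gibbsAverage μ γ = s ∧
        (∀ γ' : ℝ, 0 ≤ γ' →
          Real.log (partitionFn μ γ') + γ' * gibbsAverage μ γ' = s → γ' = γ) ∧
        relaxedJmin μ s = gibbsAverage μ γ ∧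
        sigmaMin K < relaxedJmin μ s) ∧
    -- maximal-entanglement regime
    (s = Real.log N →
      Jmin K s = (1 / (N : ℝ)) * ∑ i, α i * β (Fin.rev i) ∧
      relaxedJmin μ s = (1 / (N : ℝ)) * ∑ i, μ i ∧
      ∀ t : ℝ, t ≤ Real.log N → Jmin K t ≤ Jmin K s) :=
  mainTheorem3_general (localObservable_posSemidef EA MA a) (localObservable_posSemidef EB MB b)
    K hK α β μ hα hβ hμ dmin hdmin s hs
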